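/- Assume $\mathfrak b=\mathfrak c$, where $\mathfrak b$ is the bounding number (the least cardinality of a family $A\subseteq{}^\omega\omega$ such that no $g\in{}^\omega\omega$ satisfies: for every $f\in A$, $f(n)\le g(n)$ for all but finitely many $n$) and $\mathfrak c$ is the cardinality of the continuum. A free ultrafilter $u$ on $\omega$ is a P-point if for every partition $(V_n)_{n<\omega}$ of $\omega$ there is $U\in u$ such that either $U\subseteq V_n$ for some $n$, or $U\cap V_n$ is finite for all $n$. For filters on $\omega$ write $\mathcal G\le_{RK}\mathcal F$ if there is $h:\omega\to\omega$ with $h^{-1}(G)\in\mathcal F$ for all $G\in\mathcal G$, and $\mathcal G<_{RK}\mathcal F$ if $\mathcal G\le_{RK}\mathcal F$ and $\mathcal F\not\le_{RK}\mathcal G$. Then for every ordinal $\gamma$ with $0<\gamma<\mathfrak b^{+}$ and every P-point $p$ there is a family $(p_\alpha)$ of P-points, indexed by those ordinals $\alpha<\gamma$ that are $0$ or a successor ordinal, such that $p_0=p$ and $p_\alpha<_{RK}p_\beta$ whenever $\alpha<\beta$ are two such indices. -/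

import Mathlib

open Filter Cardinal

/-- A (free) ultrafilter on `ω` is a P-point if for each partition `(V n)` of `ω` (blocks may be
empty) it has an element that is contained in one block or meets every block in a finite set. -/
def IsPPoint (u : Ultrafilter ℕ) : Prop :=
  (u : Filter ℕ) ≤ cofinite ∧
    ∀ V : ℕ → Set ℕ, Pairwise (Function.onFun Disjoint V) → (⋃ n, V n) = Set.univ →
      ∃ U ∈ u, (∃ n, U ⊆ V n) ∨ ∀ n, (U ∩ V n).Finite

/-- `RKLE G F`: the filter `F` is RK-greater than (or equivalent to) the filter `G`. -/
def RKLE (G F : Filter ℕ) : Prop :=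
  ∃ h : ℕ → ℕ, ∀ s ∈ G, h ⁻¹' s ∈ F

/-- The strict Rudin–Keisler order. -/
def RKLT (G F : Filter ℕ) : Prop :=
  RKLE G F ∧ ¬ RKLE F G

/-- A family of functions `ω → ω` is unbounded if no single function dominates all its members,
where `g` dominates `f` if `f n ≤ g n` for all but finitely many `n`. -/
def IsUnboundedFamily (A : Set (ℕ → ℕ)) : Prop :=
  ¬ ∃ g : ℕ → ℕ, ∀ f ∈ A, ∀ᶠ n in cofinite, f n ≤ g n

/-- The bounding number `𝔟`. -/
noncomputable def boundingNumber : Cardinal.{0} :=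
  sInf {κ | ∃ A : Set (ℕ → ℕ), IsUnboundedFamily A ∧ #A = κ}

/-- The class consisting of `0` and the successor ordinals. -/
def IsZeroOrSucc (α : Ordinal.{0}) : Prop :=
  α = 0 ∨ ∃ δ : Ordinal.{0}, α = Order.succ δ

/-! Code pairs `(n, x)` with `x < n ^ n` by natural numbers and call a set of codes small if its
sections have at most `k * n ^ (n - 1)` elements for some `k` and `p`-almost all `n`. Since `𝔟 = 𝔠`,
a recursion of length `𝔠` that handles one partition of `ω` at a time produces a P-point `q` without
small members: at a stage generated by fewer than `𝔟` sets, `p` being a P-point reduces the search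
for a pseudo-intersection to bounding fewer than `𝔟` functions.

Choose functions `φ α` for which `id - φ α` and, whenever `α < β`, `φ β - φ α` tend to infinity, and
let `p α` be the image of `q` under `(n, x) ↦ (n, x % n ^ φ α n)`. It projects to `p`, and `p β`
projects to `p α` for `α < β`. If conversely `p β` were an image of `p α`, then, since a self-map
fixing an ultrafilter is the identity on a member of it, the residues modulo `n ^ φ α n` would
determine those modulo `n ^ φ β n` on a member of `q`; but the sections of such a set eventually
have at most `n ^ (n - 1)` elements.
-/

universe u

section Transfinite

theorem exists_forall_rel_of_wellFounded {I X : Type*} [Nonempty X] {r : I → I → Prop}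
    (hr : WellFounded r) (R : ∀ i, (∀ j, r j i → X) → X → Prop)
    (hstep : ∀ (f : I → X) i, (∀ j, r j i → R j (fun k _ => f k) (f j)) →
      ∃ x, R i (fun j _ => f j) x) :
    ∃ f : I → X, ∀ i, R i (fun j _ => f j) (f i) := by
  classical
  let f : I → X := hr.fix fun i v => Classical.epsilon (R i v)
  have hf (i : I) : f i = Classical.epsilon (R i fun j _ => f j) := hr.fix_eq _ i
  refine ⟨f, fun i => ?_⟩
  induction i using hr.induction with
  | _ i ih =>
    rw [hf i]
    exact Classical.epsilon_spec (hstep f i ih)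

theorem exists_isWellOrder_mk_lt (I : Type u) :
    ∃ r : I → I → Prop, IsWellOrder I r ∧ ∀ i, #{j // r j i} < #I := by
  obtain ⟨r, hwo, hr⟩ := exists_ord_eq I
  exact ⟨r, hwo, fun i => (Ordinal.card_typein i).trans_lt (card_typein_lt i hr)⟩

end Transfinite

section Rigidity

variable {α : Type*} {g : α → α}

theorem notMem_of_forall_exists_iterate_notMem {u : Ultrafilter α} (hg : u.map g = u) {D : Set α}
    (hD : ∀ x ∈ D, ∃ n, g^[n] x ∉ D) : D ∉ u := by
  intro hDu
  -- The parity of the exit time alternates along `g`, but `u` cannot distinguish `x` from `g x`.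
  let exitTime : α → ℕ := fun x => sInf {n | g^[n] x ∉ D}
  have exitTime_apply : ∀ x ∈ D, exitTime (g x) + 1 = exitTime x := by
    intro x hx
    have hpos : exitTime x ≠ 0 := fun h0 => by
      have hexit : g^[exitTime x] x ∉ D := Nat.sInf_mem (hD x hx)
      rw [h0] at hexit
      exact hexit hx
    exact Nat.sInf_add (p := fun n => g^[n] x ∉ D) (Nat.one_le_iff_ne_zero.2 hpos)
  have hflip : ∀ x ∈ D, Even (exitTime x) ↔ ¬ Even (exitTime (g x)) := fun x hx => by
    rw [← exitTime_apply x hx, Nat.even_add_one]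
  have hmap : (∀ᶠ x in u, Even (exitTime (g x))) ↔ ∀ᶠ x in u, Even (exitTime x) :=
    Iff.of_eq (congrArg (fun v : Ultrafilter α => ∀ᶠ x in v, Even (exitTime x)) hg)
  refine iff_not_self (a := ∀ᶠ x in u, Even (exitTime x)) ?_
  calc (∀ᶠ x in u, Even (exitTime x))
      ↔ ∀ᶠ x in u, ¬ Even (exitTime (g x)) := eventually_congr (mem_of_superset hDu hflip)
    _ ↔ ¬ ∀ᶠ x in u, Even (exitTime (g x)) := Ultrafilter.eventually_not
    _ ↔ ¬ ∀ᶠ x in u, Even (exitTime x) := not_congr hmap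

/-- The grand orbit relation of `g`: two points are related if their forward orbits meet. -/
def grandOrbitRel (g : α → α) : Setoid α where
  r x y := ∃ i j, g^[i] x = g^[j] y
  iseqv :=
    { refl := fun _ => ⟨0, 0, rfl⟩
      symm := fun ⟨i, j, h⟩ => ⟨j, i, h.symm⟩
      trans := fun {x y z} ⟨i, j, hxy⟩ ⟨k, l, hyz⟩ => ⟨k + i, j + l, by
        rw [Function.iterate_add_apply, hxy, ← Function.iterate_add_apply, add_comm,
          Function.iterate_add_apply, hyz, ← Function.iterate_add_apply]⟩ }

theorem exists_index_iterate (g : α → α) :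
    ∃ k : α → ℕ, ∀ x, ∃ N, ∀ n ≥ N, k (g (g^[n] x)) ≤ k (g^[n] x) + 1 ∧
      (k (g (g^[n] x)) = k (g^[n] x) → g (g^[n] x) = g^[n] x) := by
  let root : α → α := fun x => (Quotient.mk (grandOrbitRel g) x).out
  have root_apply (x : α) : root (g x) = root x :=
    congrArg Quotient.out (Quotient.sound ⟨0, 1, rfl⟩)
  have root_iterate (n : ℕ) (x : α) : root (g^[n] x) = root x := by
    induction n generalizing x with
    | zero => rfl
    | succ n ih => rw [Function.iterate_succ_apply, ih, root_apply]
  -- `k x` is meaningful only on the forward orbit of `root x`, which the orbit of `x` enters; until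
  -- then it is `sInf ∅ = 0`.
  let k : α → ℕ := fun x => sInf {n | g^[n] (root x) = x}
  have iterate_k {x : α} (hx : ∃ n, g^[n] (root x) = x) : g^[k x] (root x) = x := Nat.sInf_mem hx
  refine ⟨k, fun x => ?_⟩
  obtain ⟨i, j, hij⟩ : ∃ i j, g^[i] x = g^[j] (root x) :=
    Quotient.exact (Quotient.out_eq (Quotient.mk (grandOrbitRel g) x)).symm
  refine ⟨i, fun n hn => ?_⟩
  have hy : ∃ m, g^[m] (root (g^[n] x)) = g^[n] x := by
    refine ⟨n - i + j, ?_⟩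
    rw [root_iterate, Function.iterate_add_apply, ← hij, ← Function.iterate_add_apply,
      Nat.sub_add_cancel hn]
  generalize g^[n] x = y at hy
  have hgy : g^[k y + 1] (root (g y)) = g y := by
    rw [root_apply, Function.iterate_succ_apply', iterate_k hy]
  refine ⟨Nat.sInf_le hgy, fun hk => ?_⟩
  rw [← iterate_k ⟨_, hgy⟩, hk, root_apply, iterate_k hy]

theorem exists_iterate_mem_and_notMem (g : α → α) :
    ∃ S : Set α, ∀ x, (∀ n, g (g^[n] x) ≠ g^[n] x) →
      (∃ n, g^[n] x ∈ S) ∧ ∃ n, g^[n] x ∉ S := by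
  obtain ⟨k, hk⟩ := exists_index_iterate g
  refine ⟨{x | Even (k x)}, fun x hx => ?_⟩
  obtain ⟨N, hN⟩ := hk x
  obtain ⟨n, hn⟩ : ∃ n, ¬ k (g^[N + (n + 1)] x) < k (g^[N + n] x) :=
    WellFounded.not_rel_apply_succ (r := (· < ·)) fun n => k (g^[N + n] x)
  rw [← add_assoc, Function.iterate_succ_apply'] at hn
  obtain ⟨hle, hne⟩ := hN (N + n) (by omega)
  have hsucc : k (g (g^[N + n] x)) = k (g^[N + n] x) + 1 := by
    have := mt hne (hx (N + n))
    omega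
  rcases Nat.even_or_odd (k (g^[N + n] x)) with heven | hodd
  · refine ⟨⟨N + n, heven⟩, N + n + 1, ?_⟩
    rw [Function.iterate_succ_apply']
    simpa [hsucc, Nat.even_add_one] using heven
  · refine ⟨⟨N + n + 1, ?_⟩, N + n, Nat.not_even_iff_odd.2 hodd⟩
    rw [Function.iterate_succ_apply']
    simpa [hsucc, Nat.even_add_one] using hodd

theorem eventually_apply_eq_self_of_map_eq {u : Ultrafilter α} (hg : u.map g = u) :
    ∀ᶠ x in u, g x = x := by
  by_contra hfix
  have hmoved : {x | g x ≠ x} ∈ u := Ultrafilter.eventually_not.2 hfix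
  obtain ⟨S, hS⟩ := exists_iterate_mem_and_notMem g
  have hsplit : ∀ T : Set α, (∀ x, (∀ n, g (g^[n] x) ≠ g^[n] x) → ∃ n, g^[n] x ∉ T) → T ∉ u := by
    intro T hT hTu
    refine notMem_of_forall_exists_iterate_notMem hg ?_ (inter_mem hmoved hTu)
    intro x _
    by_contra! hstay
    obtain ⟨n, hn⟩ := hT x fun n => (hstay n).1
    exact hn (hstay n).2
  have hSu : Sᶜ ∈ u := Ultrafilter.compl_mem_iff_notMem.2 (hsplit S fun x hx => (hS x hx).2)
  exact hsplit Sᶜ (fun x hx => by simpa using (hS x hx).1) hSu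

end Rigidity

section RudinKeisler

theorem RKLE.trans {F G H : Filter ℕ} : RKLE F G → RKLE G H → RKLE F H := by
  rintro ⟨f, hf⟩ ⟨g, hg⟩
  exact ⟨f ∘ g, fun s hs => hg _ (hf s hs)⟩

theorem RKLE.trans_rklt {F G H : Filter ℕ} (hFG : RKLE F G) (hGH : RKLT G H) : RKLT F H :=
  ⟨hFG.trans hGH.1, fun hHF => hGH.2 (hHF.trans hFG)⟩

theorem rkle_coe_iff {u v : Ultrafilter ℕ} :
    RKLE (u : Filter ℕ) (v : Filter ℕ) ↔ ∃ h : ℕ → ℕ, v.map h = u := by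
  refine exists_congr fun h => ⟨fun hle => Ultrafilter.eq_of_le fun s hs => hle s hs, ?_⟩
  rintro rfl s hs
  exact hs

theorem rklt_map_map {α : Type*} {q : Ultrafilter α} {f f' : α → ℕ} {π : ℕ → ℕ}
    (hπ : ∀ᶠ x in q, π (f' x) = f x)
    (hinj : ∀ A : Set α, (∀ x ∈ A, ∀ y ∈ A, f x = f y → f' x = f' y) → A ∉ q) :
    RKLT (q.map f : Filter ℕ) (q.map f' : Filter ℕ) := by
  have hmap : (q.map f').map π = q.map f :=
    Ultrafilter.coe_injective (map_congr hπ)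
  refine ⟨rkle_coe_iff.2 ⟨π, hmap⟩, fun hle => ?_⟩
  obtain ⟨h, hh⟩ := rkle_coe_iff.1 hle
  have hfix : ∀ᶠ x in q, h (π (f' x)) = f' x :=
    eventually_apply_eq_self_of_map_eq (u := q.map f') (g := h ∘ π)
      (by rw [← Ultrafilter.map_map, hmap, hh])
  refine hinj {x | h (f x) = f' x} (fun x hx y hy hxy => ?_) ?_
  · rw [← show h (f x) = f' x from hx, hxy, show h (f y) = f' y from hy]
  · filter_upwards [hfix, hπ] with x hx hπx
    rwa [hπx] at hx

end RudinKeisler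

section PPoint

/-- A set is homogeneous for `V` if it is contained in one of the sets `V n` or almost disjoint from
all of them; this is the alternative in the definition of a P-point. -/
def IsHomogeneousFor {α : Type*} (V : ℕ → Set α) (U : Set α) : Prop :=
  (∃ n, U ⊆ V n) ∨ ∀ n, (U ∩ V n).Finite

variable {p : Ultrafilter ℕ}

theorem IsPPoint.le_atTop (hp : IsPPoint p) : (p : Filter ℕ) ≤ atTop :=
  Nat.cofinite_eq_atTop ▸ hp.1

theorem IsPPoint.map (hp : IsPPoint p) {f : ℕ → ℕ} (hf : (p.map f : Filter ℕ) ≤ cofinite) :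
    IsPPoint (p.map f) := by
  refine ⟨hf, fun V hV hcov => ?_⟩
  obtain ⟨U, hU, hhom⟩ := hp.2 (fun n => f ⁻¹' V n) (fun i j hij => (hV hij).preimage f)
    (by rw [← Set.preimage_iUnion, hcov, Set.preimage_univ])
  refine ⟨f '' U, image_mem_map hU, hhom.imp ?_ fun hfin n => ?_⟩
  · rintro ⟨n, hn⟩
    exact ⟨n, Set.image_subset_iff.2 hn⟩
  · rw [← Set.image_inter_preimage]
    exact (hfin n).image f

theorem le_cofinite_of_map_le_cofinite {α β : Type*} {f : α → β} {F : Filter α}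
    (h : F.map f ≤ cofinite) : F ≤ cofinite :=
  (map_le_iff_le_comap.1 h).trans (comap_cofinite_le f)

theorem IsPPoint.exists_mem_tendsto (hp : IsPPoint p) {h : ℕ → ℕ} (hh : Tendsto h p atTop) :
    ∃ S ∈ p, Tendsto h (atTop ⊓ 𝓟 S) atTop := by
  obtain ⟨S, hS, hhom⟩ := hp.2 (fun k => h ⁻¹' {k})
    (fun i j hij => (Set.disjoint_singleton.2 hij).preimage h)
    (Set.eq_univ_of_forall fun n => Set.mem_iUnion.2 ⟨h n, rfl⟩)
  refine ⟨S, hS, tendsto_atTop.2 fun k => ?_⟩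
  have hfin : ∀ m, (S ∩ h ⁻¹' {m}).Finite := by
    refine hhom.resolve_left ?_
    rintro ⟨m, hm⟩
    obtain ⟨n, hnS, hn⟩ := p.nonempty_of_mem (inter_mem hS (hh.eventually_gt_atTop m))
    exact hn.ne' (hm hnS)
  have hbelow : {n ∈ S | h n < k}.Finite := by
    refine ((Set.finite_Iio k).biUnion fun m _ => hfin m).subset fun n hn => ?_
    exact Set.mem_biUnion (x := h n) hn.2 ⟨hn.1, rfl⟩
  rw [eventually_inf_principal, ← Nat.cofinite_eq_atTop]
  filter_upwards [hbelow.compl_mem_cofinite] with n hn hnS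
  exact not_lt.1 fun hlt => hn ⟨hnS, hlt⟩

theorem IsPPoint.exists_tendsto_atTop_eventually (hp : IsPPoint p) {Q : ℕ → ℕ → Prop}
    (hQ : ∀ k, ∀ᶠ n in p, Q k n) :
    ∃ h : ℕ → ℕ, Tendsto h atTop atTop ∧ ∀ᶠ n in p, Q (h n) n := by
  classical
  let h : ℕ → ℕ := fun n => Nat.findGreatest (Q · n) n
  have hh : Tendsto h p atTop := tendsto_atTop.2 fun k => by
    filter_upwards [hQ k, hp.le_atTop (eventually_ge_atTop k)] with n hn hkn
    exact Nat.le_findGreatest hkn hn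
  obtain ⟨S, hS, hhS⟩ := hp.exists_mem_tendsto hh
  refine ⟨S.piecewise h id, hhS.piecewise (tendsto_inf_left tendsto_id), ?_⟩
  filter_upwards [hS, hh.eventually_gt_atTop 0] with n hn hpos
  rw [Set.piecewise_eq_of_mem _ _ _ hn]
  exact Nat.findGreatest_of_ne_zero (P := (Q · n)) rfl hpos.ne'

end PPoint

section BoundingNumber

theorem exists_dominating {ι : Type u} (hι : #ι < lift.{u} boundingNumber) (f : ι → ℕ → ℕ) :
    ∃ g : ℕ → ℕ, ∀ i, f i ≤ᶠ[atTop] g := by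
  by_contra! hunb
  have hrange : IsUnboundedFamily (Set.range f) := by
    rintro ⟨g, hg⟩
    obtain ⟨i, hi⟩ := hunb g
    exact hi (Nat.cofinite_eq_atTop ▸ hg (f i) ⟨i, rfl⟩)
  have hle : boundingNumber ≤ #(Set.range f) := csInf_le' ⟨_, hrange, rfl⟩
  have : lift.{u} #(Set.range f) ≤ lift.{0} #ι := mk_range_le_lift
  rw [lift_id'] at this
  exact hι.not_ge ((lift_le.2 hle).trans this)

theorem exists_tendsto_atTop_le {ι : Type u} (hι : #ι < lift.{u} boundingNumber) {d : ι → ℕ → ℕ}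
    (hd : ∀ i, Tendsto (d i) atTop atTop) :
    ∃ g : ℕ → ℕ, Tendsto g atTop atTop ∧ ∀ i, g ≤ᶠ[atTop] d i := by
  have hm (i k) : ∃ m, ∀ n ≥ m, k ≤ d i n :=
    eventually_atTop.1 ((hd i).eventually_ge_atTop k)
  choose m hm using hm
  obtain ⟨M, hM⟩ := exists_dominating hι m
  let g : ℕ → ℕ := fun n => Nat.findGreatest (fun k => M k ≤ n) n
  have hg : Tendsto g atTop atTop := tendsto_atTop.2 fun k => by
    filter_upwards [eventually_ge_atTop k, eventually_ge_atTop (M k)] with n hkn hMn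
    exact Nat.le_findGreatest hkn hMn
  refine ⟨g, hg, fun i => ?_⟩
  filter_upwards [hg.eventually (hM i), hg.eventually_gt_atTop 0] with n hmM hpos
  have hMn : M (g n) ≤ n := Nat.findGreatest_of_ne_zero (P := fun k => M k ≤ n) rfl hpos.ne'
  exact hm i (g n) n (hmM.trans hMn)

end BoundingNumber

section FarBelow

/-- `f` is far below `g` if `g - f` tends to infinity. Truncated subtraction is harmless here: it
forces `f n < g n` eventually. -/
def FarBelow (f g : ℕ → ℕ) : Prop :=
  Tendsto (fun n => g n - f n) atTop atTop

theorem FarBelow.eventually_lt {f g : ℕ → ℕ} (hfg : FarBelow f g) : ∀ᶠ n in atTop, f n < g n := by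
  filter_upwards [Tendsto.eventually_gt_atTop hfg 0] with n hn
  exact Nat.sub_pos_iff_lt.1 hn

theorem FarBelow.trans {f g h : ℕ → ℕ} (hfg : FarBelow f g) (hgh : FarBelow g h) :
    FarBelow f h := by
  refine tendsto_atTop_mono' atTop ?_ hgh
  filter_upwards [hfg.eventually_lt] with n hn
  exact Nat.sub_le_sub_left hn.le _

theorem exists_farBelow_between {ι : Type u} (hι : #ι < lift.{u} boundingNumber)
    {f : ι → ℕ → ℕ} {r : ℕ → ℕ} (hf : ∀ i, FarBelow (f i) r) (hr : Tendsto r atTop atTop) :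
    ∃ x : ℕ → ℕ, Tendsto x atTop atTop ∧ FarBelow x r ∧ ∀ i, FarBelow (f i) x := by
  obtain ⟨g, hg, hgf⟩ := exists_tendsto_atTop_le hι hf
  let d : ℕ → ℕ := fun n => min (g n) (r n) / 2
  have hd : Tendsto d atTop atTop := tendsto_atTop.2 fun k => by
    filter_upwards [hg.eventually_ge_atTop (2 * k), hr.eventually_ge_atTop (2 * k)] with n hgn hrn
    simp only [d]
    omega
  refine ⟨fun n => r n - d n, ?_, ?_, fun i => ?_⟩
  · exact tendsto_atTop_mono (fun n => by simp only [d]; omega) hd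
  · exact tendsto_atTop_mono (fun n => by simp only [d]; omega) hd
  · refine tendsto_atTop_mono' atTop ?_ hd
    filter_upwards [hgf i] with n hn
    simp only [d]
    omega

theorem exists_farBelow_insert {I : Type u} [LinearOrder I] [WellFoundedLT I] {S : Set I}
    (hS : #S < lift.{u} boundingNumber) {φ : I → ℕ → ℕ} {t : ℕ → ℕ} (ht : Tendsto t atTop atTop)
    (hφ : ∀ j ∈ S, Tendsto (φ j) atTop atTop) (hφt : ∀ j ∈ S, FarBelow (φ j) t)
    (hφφ : ∀ j ∈ S, ∀ k ∈ S, j < k → FarBelow (φ j) (φ k)) (i : I) :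
    ∃ x : ℕ → ℕ, Tendsto x atTop atTop ∧ FarBelow x t ∧
      ∀ j ∈ S, (j < i → FarBelow (φ j) x) ∧ (i < j → FarBelow x (φ j)) := by
  have hbelow : #{j // j ∈ S ∧ j < i} < lift.{u} boundingNumber :=
    (mk_le_mk_of_subset fun _ hj => hj.1).trans_lt hS
  rcases {j | j ∈ S ∧ i < j}.eq_empty_or_nonempty with hempty | hne
  · obtain ⟨x, hx, hxt, hφx⟩ := exists_farBelow_between hbelow (fun j => hφt j.1 j.2.1) ht
    exact ⟨x, hx, hxt, fun j hj => ⟨fun hji => hφx ⟨j, hj, hji⟩,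
      fun hij => (Set.eq_empty_iff_forall_notMem.1 hempty j ⟨hj, hij⟩).elim⟩⟩
  · obtain ⟨m, ⟨hmS, him⟩, hmin⟩ := wellFounded_lt.has_min _ hne
    obtain ⟨x, hx, hxm, hφx⟩ := exists_farBelow_between hbelow
      (fun j => hφφ j.1 j.2.1 m hmS (j.2.2.trans him)) (hφ m hmS)
    refine ⟨x, hx, hxm.trans (hφt m hmS), fun j hj => ⟨fun hji => hφx ⟨j, hj, hji⟩, fun hij => ?_⟩⟩
    rcases (not_lt.1 (hmin j ⟨hj, hij⟩)).eq_or_lt with rfl | hmj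
    · exact hxm
    · exact hxm.trans (hφφ m hmS j hj hmj)

theorem rel_of_lt_of_forall_rel {I X : Type*} [Preorder I] {r : I → I → Prop} [IsWellOrder I r]
    {P : X → X → Prop} {f : I → X} {j k : I}
    (hj : ∀ l, r l j → (l < j → P (f l) (f j)) ∧ (j < l → P (f j) (f l)))
    (hk : ∀ l, r l k → (l < k → P (f l) (f k)) ∧ (k < l → P (f k) (f l))) (hjk : j < k) :
    P (f j) (f k) := by
  rcases trichotomous_of r j k with h | h | h
  · exact (hk j h).1 hjk
  · exact absurd h hjk.ne
  · exact (hj k h).2 hjk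

theorem exists_farBelow_chain {I : Type u} [LinearOrder I] [WellFoundedLT I]
    (hI : #I ≤ lift.{u} boundingNumber) :
    ∃ φ : I → ℕ → ℕ, (∀ i, FarBelow (φ i) id) ∧ ∀ i j, i < j → FarBelow (φ i) (φ j) := by
  -- Not along `<`, which may have `𝔟` predecessors at a single stage.
  obtain ⟨r, hwo, hr⟩ := exists_isWellOrder_mk_lt I
  obtain ⟨φ, hφ⟩ := exists_forall_rel_of_wellFounded (X := ℕ → ℕ) (r := r) hwo.wf
    (fun i v x => Tendsto x atTop atTop ∧ FarBelow x id ∧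
      ∀ j (hj : r j i), (j < i → FarBelow (v j hj) x) ∧ (i < j → FarBelow x (v j hj)))
    fun φ i ih => exists_farBelow_insert (S := {j | r j i}) ((hr i).trans_le hI) tendsto_id
      (fun j hj => (ih j hj).1) (fun j hj => (ih j hj).2.1)
      (fun j hj k hk => rel_of_lt_of_forall_rel (ih j hj).2.2 (ih k hk).2.2) i
  exact ⟨φ, fun i => (hφ i).2.1, fun i j => rel_of_lt_of_forall_rel (hφ i).2.2 (hφ j).2.2⟩

end FarBelow

section CoSmall

variable {ι α : Type*}

/-- The filter dual to the ideal of the sets that meet the blocks `B n` in `O(s n)` points, as `n`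
runs along `l`. It serves as the base of the recursion that constructs the P-point above `p`. -/
def coSmallFilter (l : Filter ι) (B : ι → Finset α) (s : ι → ℕ) : Filter α where
  sets := {A | ∃ k, ∀ᶠ n in l, (↑(B n) \ A).ncard ≤ k * s n}
  univ_sets := ⟨0, .of_forall fun n => by simp⟩
  sets_of_superset := by
    rintro A A' ⟨k, hk⟩ hAA'
    refine ⟨k, hk.mono fun n hn => le_trans ?_ hn⟩
    exact Set.ncard_le_ncard (Set.sdiff_subset_sdiff_right hAA') (Set.toFinite _)
  inter_sets := by
    rintro A A' ⟨k, hk⟩ ⟨k', hk'⟩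
    refine ⟨k + k', ?_⟩
    filter_upwards [hk, hk'] with n hn hn'
    rw [Set.sdiff_inter, add_mul]
    exact (Set.ncard_union_le _ _).trans (add_le_add hn hn')

variable {l : Filter ι} {p : Ultrafilter ι} {B : ι → Finset α} {s : ι → ℕ}

theorem mem_coSmallFilter {A : Set α} :
    A ∈ coSmallFilter l B s ↔ ∃ k, ∀ᶠ n in l, (↑(B n) \ A).ncard ≤ k * s n :=
  Iff.rfl

theorem frequently_coSmallFilter {A : Set α} :
    (∃ᶠ x in coSmallFilter (p : Filter ι) B s, x ∈ A) ↔
      ∀ k, ∀ᶠ n in p, k * s n < (↑(B n) ∩ A).ncard := by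
  change ¬ (∃ k, ∀ᶠ n in p, (↑(B n) \ Aᶜ).ncard ≤ k * s n) ↔ _
  simp only [not_exists, ← Ultrafilter.eventually_not, not_le, Set.sdiff_compl]

theorem tendsto_coSmallFilter {f : α → ι} (hf : ∀ n, ∀ x ∈ B n, f x = n) :
    Tendsto f (coSmallFilter l B s) l := by
  intro t ht
  refine ⟨0, mem_of_superset ht fun n hn => ?_⟩
  have hempty : (↑(B n) \ f ⁻¹' t : Set α) = ∅ :=
    Set.sdiff_eq_empty.2 fun x hx => by rwa [Set.mem_preimage, hf n x hx]
  simp [hempty]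

end CoSmall

section PseudoIntersection

variable {p : Ultrafilter ℕ} {α : Type*} {B : ℕ → Finset α} {s : ℕ → ℕ}

theorem IsPPoint.exists_pseudoIntersection (hp : IsPPoint p) {κ : Type u}
    (hκ : #κ < lift.{u} boundingNumber) {F : Filter α} {A : κ → Set α}
    (hF : F.HasBasis (fun _ => True) A) [NeBot (coSmallFilter p B s ⊓ F)] {W : ℕ → Set α}
    (hWanti : Antitone W) (hW : ∀ k, W k ∈ coSmallFilter p B s ⊓ F) :
    ∃ U : Set α, (∀ k, (U \ W k).Finite) ∧ NeBot (coSmallFilter p B s ⊓ F ⊓ 𝓟 U) := by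
  have hlarge (i : κ) (k : ℕ) : ∀ᶠ n in p, k * s n < (↑(B n) ∩ (A i ∩ W k)).ncard := by
    have hmem : ∀ᶠ x in coSmallFilter p B s ⊓ F, x ∈ A i ∩ W k :=
      inter_mem (mem_inf_of_right (hF.mem_of_mem trivial)) (hW k)
    exact frequently_coSmallFilter.1 (hmem.frequently.filter_mono inf_le_left) k
  -- A function `g` below every `h i` decides how far into `W` the set `U` goes on each block.
  choose h hh hhlarge using fun i => hp.exists_tendsto_atTop_eventually (hlarge i)
  obtain ⟨g, hg, hgh⟩ := exists_tendsto_atTop_le hκ hh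
  let U : Set α := ⋃ n, ↑(B n) ∩ W (g n)
  refine ⟨U, fun k => ?_, ?_⟩
  · have hfin : {n | ¬ k ≤ g n}.Finite :=
      eventually_cofinite.1 (Nat.cofinite_eq_atTop ▸ hg.eventually_ge_atTop k)
    refine (hfin.biUnion fun n _ => (B n).finite_toSet).subset ?_
    rintro x ⟨hxU, hxW⟩
    obtain ⟨n, hxB, hxWn⟩ := Set.mem_iUnion.1 hxU
    exact Set.mem_biUnion (x := n) (fun hkn => hxW (hWanti hkn hxWn)) hxB
  · rw [inf_assoc, inf_neBot_iff_frequently_right]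
    intro P hP
    obtain ⟨i, -, hi⟩ := (hF.inf_principal U).mem_iff.1 hP
    refine Frequently.mono (frequently_coSmallFilter.2 fun k => ?_) hi
    filter_upwards [hhlarge i, hp.le_atTop (hgh i), hp.le_atTop ((hh i).eventually_ge_atTop k)]
      with n hn hgn hkn
    refine (Nat.mul_le_mul_right _ hkn).trans_lt (hn.trans_le ?_)
    refine Set.ncard_le_ncard ?_ (Set.toFinite _)
    rintro x ⟨hxB, hxA, hxW⟩
    exact ⟨hxB, hxA, Set.mem_iUnion.2 ⟨n, hxB, hWanti hgn hxW⟩⟩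

end PseudoIntersection

section Recursion

theorem hasBasis_iInf_principal_finset {ι α : Type*} (A : ι → Set α) :
    (⨅ i, 𝓟 (A i)).HasBasis (fun _ : Finset ι => True) fun t => ⋂ i ∈ t, A i :=
  ⟨fun U => by simp only [mem_iInf_finite, iInf_principal_finset, mem_principal, true_and]⟩

theorem mk_finset_lt {c : Cardinal.{u}} (hc : ℵ₀ ≤ c) {ι : Type u} (hι : #ι < c) :
    #(Finset ι) < c := by
  cases finite_or_infinite ι
  · exact (lt_aleph0_of_finite _).trans_le hc
  · rwa [mk_finset_of_infinite]

theorem neBot_inf_biInf_principal {J α : Type*} {r : J → J → Prop} [IsWellOrder J r]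
    {L : Filter α} [NeBot L] {A : J → Set α} {S : Set J}
    (hA : ∀ j ∈ S, NeBot (L ⊓ (⨅ (i) (_ : r i j), 𝓟 (A i)) ⊓ 𝓟 (A j))) :
    NeBot (L ⊓ ⨅ j ∈ S, 𝓟 (A j)) := by
  rcases S.eq_empty_or_nonempty with rfl | hS
  · simpa
  have : Nonempty S := hS.to_subtype
  let G : S → Filter α := fun j => L ⊓ (⨅ (i) (_ : r i j), 𝓟 (A i)) ⊓ 𝓟 (A j)
  have hG_anti {i j : S} (hij : r i j) : G j ≤ G i := by
    refine le_inf (le_inf (inf_le_left.trans inf_le_left) ?_) ?_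
    · refine inf_le_left.trans (inf_le_right.trans (le_iInf₂ fun k hk => ?_))
      exact iInf₂_le k (trans_of r hk hij)
    · exact inf_le_left.trans (inf_le_right.trans (iInf₂_le i.1 hij))
  have hG_directed : Directed (· ≥ ·) G := fun i j => by
    rcases trichotomous_of r i.1 j.1 with h | h | h
    · exact ⟨j, hG_anti h, le_rfl⟩
    · exact ⟨i, le_rfl, (congrArg G (Subtype.ext h)).le⟩
    · exact ⟨i, le_rfl, hG_anti h⟩
  refine (iInf_neBot_of_directed' hG_directed fun j => hA j j.2).mono (le_inf ?_ ?_)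
  · exact (iInf_le G hS.to_subtype.some).trans (inf_le_left.trans inf_le_left)
  · exact le_iInf₂ fun j hj => (iInf_le G ⟨j, hj⟩).trans inf_le_right

theorem exists_le_neBot_forall_exists_mem {J : Type u} {α : Type*} (H : J → Set α → Prop)
    {L : Filter α} [NeBot L]
    (hstep : ∀ (S : Set J) (A : J → Set α), #S < #J → NeBot (L ⊓ ⨅ j ∈ S, 𝓟 (A j)) →
      ∀ j, ∃ U, H j U ∧ NeBot (L ⊓ (⨅ j ∈ S, 𝓟 (A j)) ⊓ 𝓟 U)) :
    ∃ F ≤ L, NeBot F ∧ ∀ j, ∃ U ∈ F, H j U := by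
  obtain ⟨r, hwo, hr⟩ := exists_isWellOrder_mk_lt J
  obtain ⟨A, hA⟩ := exists_forall_rel_of_wellFounded (X := Set α) (r := r) hwo.wf
    (fun j v U => H j U ∧ NeBot (L ⊓ (⨅ (i) (hi : r i j), 𝓟 (v i hi)) ⊓ 𝓟 U))
    fun A j ih => hstep {i | r i j} A (hr j)
      (neBot_inf_biInf_principal (r := r) fun i hi => (ih i hi).2) j
  refine ⟨L ⊓ ⨅ j, 𝓟 (A j), inf_le_left, ?_, fun j => ⟨A j, ?_, (hA j).1⟩⟩
  · simpa using neBot_inf_biInf_principal (r := r) (S := Set.univ) fun j _ => (hA j).2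
  · exact mem_inf_of_right (mem_iInf_of_mem j (mem_principal_self _))

end Recursion

section Refinement

variable {p : Ultrafilter ℕ} {s : ℕ → ℕ}

theorem IsPPoint.exists_isHomogeneousFor (hp : IsPPoint p) {κ : Type u}
    (hκ : #κ < lift.{u} boundingNumber) {α : Type*} {B : ℕ → Finset α} {F : Filter α}
    {A : κ → Set α} (hF : F.HasBasis (fun _ => True) A) [NeBot (coSmallFilter p B s ⊓ F)]
    (V : ℕ → Set α) :
    ∃ U, IsHomogeneousFor V U ∧ NeBot (coSmallFilter p B s ⊓ F ⊓ 𝓟 U) := by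
  by_cases hV : ∃ n, NeBot (coSmallFilter p B s ⊓ F ⊓ 𝓟 (V n))
  · obtain ⟨n, hn⟩ := hV
    exact ⟨V n, .inl ⟨n, subset_rfl⟩, hn⟩
  have hcompl (n : ℕ) : (V n)ᶜ ∈ coSmallFilter p B s ⊓ F :=
    inf_principal_eq_bot.1 (not_neBot.1 (not_exists.1 hV n))
  let W : ℕ → Set α := fun k => ⋂ i ∈ Set.Iio k, (V i)ᶜ
  have hW_anti : Antitone W := fun k l hkl =>
    Set.biInter_subset_biInter_left (Set.Iio_subset_Iio hkl)
  have hW (k : ℕ) : W k ∈ coSmallFilter p B s ⊓ F :=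
    (biInter_mem (Set.finite_Iio k)).2 fun n _ => hcompl n
  obtain ⟨U, hU, hne⟩ := hp.exists_pseudoIntersection hκ hF hW_anti hW
  refine ⟨U, .inr fun n => (hU (n + 1)).subset ?_, hne⟩
  exact fun x ⟨hxU, hxV⟩ => ⟨hxU, fun hxW => Set.mem_iInter₂.1 hxW n n.lt_succ_self hxV⟩

theorem IsPPoint.exists_isPPoint_le_coSmallFilter (hp : IsPPoint p)
    (hbc : boundingNumber = continuum) {B : ℕ → Finset ℕ} [NeBot (coSmallFilter p B s)]
    (hfree : coSmallFilter p B s ≤ cofinite) :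
    ∃ q : Ultrafilter ℕ, IsPPoint q ∧ (q : Filter ℕ) ≤ coSmallFilter p B s := by
  have hJ : #(ℕ → Set ℕ) = continuum := by simp
  obtain ⟨F, hFL, hF, hhom⟩ := exists_le_neBot_forall_exists_mem (L := coSmallFilter p B s)
    IsHomogeneousFor fun S A hS hne V => by
      have hbasis := hasBasis_iInf_principal_finset fun j : S => A j
      rw [iInf_subtype] at hbasis
      refine hp.exists_isHomogeneousFor ?_ hbasis V
      rw [lift_uzero, hbc]
      exact mk_finset_lt aleph0_le_continuum (hJ ▸ hS)
  have hqF : (Ultrafilter.of F : Filter ℕ) ≤ F := Ultrafilter.of_le F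
  refine ⟨Ultrafilter.of F, ⟨hqF.trans (hFL.trans hfree), fun V _ _ => ?_⟩, hqF.trans hFL⟩
  obtain ⟨U, hUF, hU⟩ := hhom V
  exact ⟨U, hqF hUF, hU⟩

end Refinement

section Truncation

/-- The block of codes of the pairs `(n, x)` with `x < n ^ n`. -/
def powBlock (n : ℕ) : Finset ℕ :=
  (Finset.range (n ^ n)).image (Nat.pair n)

/-- The map `(n, x) ↦ (n, x % n ^ φ n)` on codes of pairs. It keeps the last `φ n` digits of `x` in
base `n`. -/
def truncate (φ : ℕ → ℕ) (z : ℕ) : ℕ :=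
  Nat.pair z.unpair.1 (z.unpair.2 % z.unpair.1 ^ φ z.unpair.1)

theorem unpair_fst_truncate (φ : ℕ → ℕ) (z : ℕ) : (truncate φ z).unpair.1 = z.unpair.1 := by
  simp [truncate]

theorem unpair_fst_of_mem_powBlock {n z : ℕ} (hz : z ∈ powBlock n) : z.unpair.1 = n := by
  obtain ⟨x, -, rfl⟩ := Finset.mem_image.1 hz
  simp

theorem truncate_truncate_of_le {φ ψ : ℕ → ℕ} {z : ℕ} (h : φ z.unpair.1 ≤ ψ z.unpair.1) :
    truncate φ (truncate ψ z) = truncate φ z := by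
  simp [truncate, Nat.mod_mod_of_dvd _ (pow_dvd_pow _ h)]

theorem ncard_le_of_mod_eq_imp_mod_eq {T : Set ℕ} {d e N : ℕ} (hd : 0 < d)
    (hT : ∀ x ∈ T, x < e * N) (hmod : ∀ x ∈ T, ∀ y ∈ T, x % d = y % d → x % e = y % e) :
    T.ncard ≤ d * N := by
  have hcard : (↑(Finset.range d ×ˢ Finset.range N) : Set (ℕ × ℕ)).ncard = d * N := by
    rw [Set.ncard_coe_finset, Finset.card_product, Finset.card_range, Finset.card_range]
  rw [← hcard]
  refine Set.ncard_le_ncard_of_injOn (fun x => (x % d, x / e)) (fun x hx => ?_) ?_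
    (Finset.finite_toSet _)
  · simpa using ⟨Nat.mod_lt x hd, Nat.div_lt_of_lt_mul (hT x hx)⟩
  · intro x hx y hy hxy
    obtain ⟨hd, he⟩ := Prod.ext_iff.1 hxy
    rw [← Nat.mod_add_div x e, ← Nat.mod_add_div y e, hmod x hx y hy hd, show x / e = y / e from he]

theorem ncard_powBlock_inter_le {φ ψ : ℕ → ℕ} {A : Set ℕ}
    (hA : ∀ x ∈ A, ∀ y ∈ A, truncate φ x = truncate φ y → truncate ψ x = truncate ψ y)
    {n : ℕ} (hn : 0 < n) (hφψ : φ n < ψ n) (hψ : ψ n ≤ n) :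
    (↑(powBlock n) ∩ A).ncard ≤ n ^ (n - 1) := by
  let T : Set ℕ := Set.Iio (n ^ n) ∩ Nat.pair n ⁻¹' A
  have himage : ↑(powBlock n) ∩ A = Nat.pair n '' T := by
    rw [powBlock, Finset.coe_image, Finset.coe_range, Set.image_inter_preimage]
  have hT : T.ncard ≤ n ^ φ n * n ^ (n - ψ n) := by
    refine ncard_le_of_mod_eq_imp_mod_eq (e := n ^ ψ n) (Nat.pow_pos hn) (fun x hx => ?_)
      fun x hx y hy hxy => ?_
    · rw [← pow_add, Nat.add_sub_of_le hψ]
      exact hx.1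
    · simpa [truncate, Nat.pair_eq_pair] using hA _ hx.2 _ hy.2 (by simp [truncate, hxy])
  calc (↑(powBlock n) ∩ A).ncard ≤ T.ncard := himage ▸ Set.ncard_image_le (Set.toFinite _)
    _ ≤ n ^ φ n * n ^ (n - ψ n) := hT
    _ ≤ n ^ (n - 1) := by
      rw [← pow_add]
      exact Nat.pow_le_pow_right hn (by omega)

theorem compl_mem_coSmallFilter_powBlock {l : Filter ℕ} (hl : l ≤ atTop) {φ ψ : ℕ → ℕ}
    (hφψ : FarBelow φ ψ) (hψ : FarBelow ψ id) {A : Set ℕ}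
    (hA : ∀ x ∈ A, ∀ y ∈ A, truncate φ x = truncate φ y → truncate ψ x = truncate ψ y) :
    Aᶜ ∈ coSmallFilter l powBlock fun n => n ^ (n - 1) := by
  refine mem_coSmallFilter.2 ⟨1, ?_⟩
  filter_upwards [hl (eventually_gt_atTop 0), hl hφψ.eventually_lt, hl hψ.eventually_lt]
    with n hn hφψn hψn
  rw [Set.sdiff_compl, one_mul]
  exact ncard_powBlock_inter_le hA hn hφψn hψn.le

theorem neBot_coSmallFilter_powBlock {p : Ultrafilter ℕ} (hp : (p : Filter ℕ) ≤ atTop) :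
    NeBot (coSmallFilter p powBlock fun n => n ^ (n - 1)) := by
  rw [← frequently_true_iff_neBot]
  refine (frequently_coSmallFilter (A := Set.univ)).2 fun k => ?_
  filter_upwards [hp (eventually_gt_atTop k)] with n hn
  have hcard : (powBlock n : Set ℕ).ncard = n * n ^ (n - 1) := by
    rw [Set.ncard_coe_finset, powBlock,
      Finset.card_image_of_injective _ fun _ _ h => (Nat.pair_eq_pair.1 h).2, Finset.card_range,
      mul_pow_sub_one (by omega)]
  rw [Set.inter_univ, hcard]
  exact Nat.mul_lt_mul_of_pos_right hn (Nat.pow_pos (by omega))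

end Truncation

section Chain

variable {p : Ultrafilter ℕ}

theorem IsPPoint.exists_forall_rklt_truncate (hp : IsPPoint p) (hbc : boundingNumber = continuum) :
    ∃ q : Ultrafilter ℕ,
      (∀ φ, IsPPoint (q.map (truncate φ)) ∧ RKLE (p : Filter ℕ) (q.map (truncate φ) : Filter ℕ)) ∧
      ∀ φ ψ, FarBelow φ ψ → FarBelow ψ id →
        RKLT (q.map (truncate φ) : Filter ℕ) (q.map (truncate ψ) : Filter ℕ) := by
  have := neBot_coSmallFilter_powBlock hp.le_atTop
  have hfst : Tendsto (fun z : ℕ => z.unpair.1)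
      (coSmallFilter p powBlock fun n => n ^ (n - 1)) p :=
    tendsto_coSmallFilter fun n z => unpair_fst_of_mem_powBlock
  obtain ⟨q, hq, hqL⟩ := hp.exists_isPPoint_le_coSmallFilter hbc
    (le_cofinite_of_map_le_cofinite (hfst.trans hp.1))
  have hqfst : q.map (fun z => z.unpair.1) = p := Ultrafilter.eq_of_le (hfst.mono_left hqL)
  have hmap_fst (φ : ℕ → ℕ) : (q.map (truncate φ)).map (fun z => z.unpair.1) = p := by
    rw [Ultrafilter.map_map, ← hqfst]
    exact congrArg q.map (funext (unpair_fst_truncate φ))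
  refine ⟨q, fun φ => ⟨?_, rkle_coe_iff.2 ⟨_, hmap_fst φ⟩⟩, fun φ ψ hφψ hψ => ?_⟩
  · refine hq.map (le_cofinite_of_map_le_cofinite (f := fun z => z.unpair.1) ?_)
    exact (congrArg (fun u : Ultrafilter ℕ => (u : Filter ℕ)) (hmap_fst φ)).trans_le hp.1
  · refine rklt_map_map (π := truncate φ) ?_ fun A hA => ?_
    · filter_upwards [(hfst.mono_left hqL).eventually (hp.le_atTop hφψ.eventually_lt)] with z hz
      exact truncate_truncate_of_le hz.le
    · exact Ultrafilter.compl_mem_iff_notMem.1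
        (hqL (compl_mem_coSmallFilter_powBlock hp.le_atTop hφψ hψ hA))

theorem IsPPoint.exists_rklt_chain (hp : IsPPoint p) (hbc : boundingNumber = continuum)
    {I : Type u} [LinearOrder I] [WellFoundedLT I] (hI : #I ≤ lift.{u} boundingNumber) :
    ∃ Q : I → Ultrafilter ℕ,
      (∀ i, IsPPoint (Q i) ∧ RKLE (p : Filter ℕ) (Q i : Filter ℕ)) ∧
      ∀ i j, i < j → RKLT (Q i : Filter ℕ) (Q j : Filter ℕ) := by
  obtain ⟨φ, hφid, hφ⟩ := exists_farBelow_chain hI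
  obtain ⟨q, hq, hqφ⟩ := hp.exists_forall_rklt_truncate hbc
  exact ⟨fun i => q.map (truncate (φ i)), fun i => hq (φ i),
    fun i j hij => hqφ _ _ (hφ i j hij) (hφid j)⟩

end Chain

theorem lemmaM0_general (hbc : boundingNumber = continuum)
    (γ : Ordinal.{0}) (hγ : γ < (Order.succ boundingNumber).ord)
    (p : Ultrafilter ℕ) (hp : IsPPoint p) :
    ∃ P : Ordinal.{0} → Ultrafilter ℕ,
      P 0 = p ∧
      (∀ α < γ, IsPPoint (P α)) ∧
      ∀ α β : Ordinal.{0}, α < β → β < γ → RKLT (P α : Filter ℕ) (P β : Filter ℕ) := by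
  classical
  have hcard : #(Set.Iio γ) ≤ lift.{1} boundingNumber := by
    rw [mk_Iio_ordinal, Cardinal.lift_le]
    exact Order.lt_succ_iff.1 (lt_ord.1 hγ)
  obtain ⟨Q, hQ, hQlt⟩ := hp.exists_rklt_chain hbc hcard
  let P : Ordinal.{0} → Ultrafilter ℕ := fun α => if h : α ≠ 0 ∧ α < γ then Q ⟨α, h.2⟩ else p
  have hP {α : Ordinal} (hα : α ≠ 0) (hαγ : α < γ) : P α = Q ⟨α, hαγ⟩ := dif_pos ⟨hα, hαγ⟩
  have hP_zero : P 0 = p := dif_neg fun h => h.1 rfl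
  refine ⟨P, hP_zero, fun α hαγ => ?_, fun α β hαβ hβγ => ?_⟩
  · rcases eq_or_ne α 0 with rfl | hα
    · rwa [hP_zero]
    · rw [hP hα hαγ]
      exact (hQ _).1
  · rw [hP hαβ.ne_bot hβγ]
    rcases eq_or_ne α 0 with rfl | hα
    · rw [hP_zero]
      exact (hQ ⟨0, hαβ.trans hβγ⟩).2.trans_rklt (hQlt _ _ hαβ)
    · rw [hP hα (hαβ.trans hβγ)]
      exact hQlt _ _ hαβ

theorem lemmaM0 (hbc : boundingNumber = Cardinal.continuum)
    (γ : Ordinal.{0}) (hγ : γ < (Order.succ boundingNumber).ord)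
    (p : Ultrafilter ℕ) (hp : IsPPoint p) :
    ∃ P : Ordinal.{0} → Ultrafilter ℕ,
      P 0 = p ∧
      (∀ α < γ, IsZeroOrSucc α → IsPPoint (P α)) ∧
      (∀ α β : Ordinal.{0}, α < β → β < γ → IsZeroOrSucc α → IsZeroOrSucc β →
        RKLT (P α : Filter ℕ) (P β : Filter ℕ)) := by
  obtain ⟨P, h0, hP, hlt⟩ := lemmaM0_general hbc γ hγ p hp
  exact ⟨P, h0, fun α hα _ => hP α hα, fun α β hαβ hβ _ _ => hlt α β hαβ hβ⟩
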